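/- Let $\tau\in\mathbb{C}$ with $\operatorname{Im}\tau>0$, and write $q=e^{2\pi i\tau}$. For $x \in \mathbb{C}$ and $|q|<1$ put $(x;q)=\prod_{n\ge 0}(1-q^n x)$, and for $x\neq 0$ put $\langle x;q\rangle=(x;q)\,(q/x;q)$. Let $\eta(\tau)=e^{\pi i\tau/12}(q;q)$ be the Dedekind eta function, and for $g\in\mathbb{Z}$ let $$E_g(\tau)=e^{7B(g/7)\pi i\tau}\,\langle q^g;q^7\rangle,\qquad B(t)=t^2-t+\tfrac16,$$ be the generalized Dedekind eta functions of level $7$. Then one has the identity of polynomials in $\mathbb{C}[X]$ $$X^3-2\frac{\eta(14\tau)^2}{\eta(7\tau)^2}X^2-\frac{\eta(2\tau)\eta(7\tau)^3}{\eta(\tau)\eta(14\tau)^3}X+\frac{\eta(2\tau)\eta(7\tau)}{\eta(\tau)\eta(14\tau)}=\prod_{g=1}^{3}\left(X-\frac{E_g(2\tau)}{E_{3g}(\tau)}\right).$$ -/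

import Mathlib

noncomputable section

namespace GenEta

/-- The infinite product `(x; q) = ∏_{n ≥ 0} (1 - q ^ n x)`, for `|q| < 1`. -/
def qProd (x q : ℂ) : ℂ := ∏' n : ℕ, (1 - q ^ n * x)

/-- The double infinite product `⟨x; q⟩ = (x; q) (q / x; q)`, for `0 < |q| < 1` and `x ≠ 0`. -/
def qProdPair (x q : ℂ) : ℂ := qProd x q * qProd (q / x) q

/-- `q = exp (2 π i τ)`. -/
def nome (τ : ℂ) : ℂ := Complex.exp (2 * Real.pi * Complex.I * τ)

/-- The polynomial `B(t) = t² - t + 1/6`. -/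
def B (t : ℂ) : ℂ := t ^ 2 - t + 1 / 6

/-- The generalized Dedekind eta function of level `N`,
`E_g(τ) = exp (N B(g/N) π i τ) ⟨q ^ g; q ^ N⟩` with `q = exp (2 π i τ)`, for `g` an integer. -/
def E (N : ℕ) (g : ℤ) (τ : ℂ) : ℂ :=
  Complex.exp (N * B (g / N) * Real.pi * Complex.I * τ) *
    qProdPair (nome τ ^ g) (nome τ ^ N)

end GenEta

end

noncomputable section

namespace GenEta

open Filter Topology Finset


/-! Write `w = etaRoot τ`, so that q = w^168, and a_k = ⟨q^k; q^7⟩, n_k = ⟨-q^k; q^7⟩. Since ⟨x²;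
q^14⟩ = ⟨x; q^7⟩⟨-x; q^7⟩, the three roots are w^98 a_1n_1/a_3, w^(-70) a_2n_2/a_1 and -w^(-70)
a_3n_3/a_2. The sign comes from q^9 = q^7·q^2 and quasi-periodicity. By Vieta (`cubic_eq_prod`)
three symmetric functions have to be matched. The a_k cancel in the product of the roots, and
n_1n_2n_3 is an eta quotient by Euler's splitting of (-q; q). The sum of the roots is
`theta_relation_seven`, because n_0 is an eta quotient too. The pairwise sum is
`theta_relation_fourteen`, rewritten at level 7 in `theta_relation_seven_inv`. Each theta relation
combines two instances of the Weierstrass three-term relation `qProdPair_three_term`. By the Jacobi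
triple product, w⟨zw⟩⟨z/w⟩ (for arbitrary nonzero z, w) is up to a constant a 2×2 determinant in
vectors attached to z and w, so the three-term relation is the Plücker identity. -/

/-! ### The Jacobi triple product. -/

/-- The finite product `(q; q)_n`, written for `q = r ^ 2`. -/
def qFact (r : ℂ) (n : ℕ) : ℂ := ∏ i ∈ range n, (1 - (r ^ 2) ^ (i + 1))

/-- The coefficient of the theta series at `x ^ k`, with `q = r ^ 2`. -/
def thetaCoeff (r : ℂ) (k : ℤ) : ℂ := (-1) ^ k * r ^ (k ^ 2 - k)

lemma one_sub_pow_ne_zero {q : ℂ} (hq : ‖q‖ < 1) (n : ℕ) : 1 - q ^ (n + 1) ≠ 0 := by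
  intro h
  have h1 : ‖q ^ (n + 1)‖ = 1 := by rw [← sub_eq_zero.mp h, norm_one]
  rw [norm_pow] at h1
  exact absurd h1 (pow_lt_one₀ (norm_nonneg _) hq (by omega)).ne

lemma norm_sq_lt_one {r : ℂ} (hr : ‖r‖ < 1) : ‖r ^ 2‖ < 1 := by
  rw [norm_pow]
  exact pow_lt_one₀ (norm_nonneg _) hr (by norm_num)

lemma qFact_ne_zero {r : ℂ} (hr : ‖r‖ < 1) (n : ℕ) : qFact r n ≠ 0 :=
  prod_ne_zero_iff.mpr fun i _ => one_sub_pow_ne_zero (norm_sq_lt_one hr) i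

lemma qFact_succ (r : ℂ) (n : ℕ) : qFact r (n + 1) = qFact r n * (1 - (r ^ 2) ^ (n + 1)) :=
  prod_range_succ _ _

lemma thetaCoeff_succ {r : ℂ} (hr0 : r ≠ 0) (k : ℤ) :
    thetaCoeff r (k + 1) = - thetaCoeff r k * (r ^ 2) ^ k := by
  unfold thetaCoeff
  rw [zpow_add₀ (by norm_num : (-1 : ℂ) ≠ 0), ← zpow_natCast r 2, ← zpow_mul,
    show (k + 1) ^ 2 - (k + 1) = (k ^ 2 - k) + ((2 : ℕ) : ℤ) * k by push_cast; ring, zpow_add₀ hr0]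
  simp [mul_assoc]

/-- The `q`-binomial theorem, for `q = r ^ 2`. -/
theorem qBinomial {r : ℂ} (hr0 : r ≠ 0) (hr : ‖r‖ < 1) (z : ℂ) (M : ℕ) :
    ∏ n ∈ range M, (1 - (r ^ 2) ^ n * z) =
      ∑ k ∈ range (M + 1),
        qFact r M / (qFact r k * qFact r (M - k)) * thetaCoeff r k * z ^ k := by
  induction M with
  | zero => simp [qFact, thetaCoeff]
  | succ M ih =>
    -- The q-Pascal rule [M+1, k+1] = [M, k+1] + q^(M-k) [M, k]. The range k < M keeps the natural
    -- subtractions genuine; the two extreme terms are `top` and `bot`.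
    have key : ∀ k ∈ range M, qFact r (M + 1) / (qFact r (k + 1) * qFact r (M + 1 - (k + 1))) *
          thetaCoeff r ((k + 1 : ℕ) : ℤ) * z ^ (k + 1) =
        qFact r M / (qFact r (k + 1) * qFact r (M - (k + 1))) *
          thetaCoeff r ((k + 1 : ℕ) : ℤ) * z ^ (k + 1) - (r ^ 2) ^ M * z *
        (qFact r M / (qFact r k * qFact r (M - k)) * thetaCoeff r k * z ^ k) := by
      intro k hk
      obtain ⟨l, rfl⟩ : ∃ l, M = k + 1 + l := ⟨M - (k + 1), by simp at hk; omega⟩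
      rw [show k + 1 + l + 1 - (k + 1) = l + 1 by omega, show k + 1 + l - (k + 1) = l by omega,
        show k + 1 + l - k = l + 1 by omega, qFact_succ r (k + 1 + l), qFact_succ r k,
        qFact_succ r l]
      push_cast
      rw [thetaCoeff_succ hr0, zpow_natCast]
      have h1 := qFact_ne_zero hr k
      have h2 := qFact_ne_zero hr l
      have h3 := one_sub_pow_ne_zero (norm_sq_lt_one hr) k
      have h4 := one_sub_pow_ne_zero (norm_sq_lt_one hr) l
      field_simp
      ring
    have top : qFact r (M + 1) / (qFact r (M + 1) * qFact r (M + 1 - (M + 1))) *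
          thetaCoeff r ((M + 1 : ℕ) : ℤ) * z ^ (M + 1) = - ((r ^ 2) ^ M * z *
        (qFact r M / (qFact r M * qFact r (M - M)) * thetaCoeff r M * z ^ M)) := by
      push_cast
      rw [thetaCoeff_succ hr0, zpow_natCast, Nat.sub_self]
      have h1 := qFact_ne_zero hr M
      have h2 := qFact_ne_zero hr (M + 1)
      field_simp
      ring
    have bot : ∀ m, qFact r m / (qFact r 0 * qFact r (m - 0)) *
          thetaCoeff r ((0 : ℕ) : ℤ) * z ^ 0 = 1 := by
      intro m
      have h1 := qFact_ne_zero hr m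
      simp [thetaCoeff, qFact] at h1 ⊢
      exact h1
    rw [prod_range_succ, ih, sum_range_succ _ (M + 1), sum_range_succ' (fun k : ℕ => qFact r (M + 1) /
      (qFact r k * qFact r (M + 1 - k)) * thetaCoeff r k * z ^ k) M, sum_congr rfl key, top, bot,
      sum_sub_distrib, ← mul_sum]
    have e1 := sum_range_succ' (fun k : ℕ => qFact r M / (qFact r k * qFact r (M - k)) *
      thetaCoeff r k * z ^ k) M
    have e2 := sum_range_succ (fun k : ℕ => qFact r M / (qFact r k * qFact r (M - k)) *
      thetaCoeff r k * z ^ k) M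
    simp only [bot] at e1
    linear_combination e1 - (r ^ 2) ^ M * z * e2

/-- The finite form of the Jacobi triple product, for `q = r ^ 2`. -/
theorem finite_tripleProduct {r : ℂ} (hr0 : r ≠ 0) (hr : ‖r‖ < 1) {x : ℂ} (hx : x ≠ 0) (N : ℕ) :
    (∏ n ∈ range N, (1 - (r ^ 2) ^ n * x)) * ∏ n ∈ range N, (1 - (r ^ 2) ^ n * (r ^ 2 / x)) =
      ∑ j ∈ Icc (-N : ℤ) N,
        qFact r (2 * N) / (qFact r (N + j).toNat * qFact r (N - j).toNat) *
          thetaCoeff r j * x ^ j := by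
  -- With z = x q^(-N) and 2N factors, the last N are those of (x; q), and the first N have negative
  -- exponents.
  have hz := qBinomial hr0 hr (x * r ^ (-2 * N : ℤ)) (2 * N)
  -- In reversed order the factors are 1 - x q^(-n-1) = -x q^(-n-1) (1 - q^n (q/x)).
  have refl : ∀ K : ℕ, ∏ n ∈ range K, (1 - (r ^ 2) ^ n * (x * r ^ (-2 * K : ℤ))) =
      (-x) ^ K * r ^ (-(K : ℤ) ^ 2 - K) * ∏ n ∈ range K, (1 - (r ^ 2) ^ n * (r ^ 2 / x)) := by
    intro K
    have step : ∀ n ∈ range K, 1 - (r ^ 2) ^ (K - 1 - n) * (x * r ^ (-2 * K : ℤ)) =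
        (-x) * r ^ (-2 * (n : ℤ) - 2) * (1 - (r ^ 2) ^ n * (r ^ 2 / x)) := by
      intro n hn
      obtain ⟨l, rfl⟩ : ∃ l, K = n + 1 + l := ⟨K - (n + 1), by simp at hn; omega⟩
      have h1 : (r ^ 2) ^ l * r ^ (-2 * ((n + 1 + l : ℕ) : ℤ)) = r ^ (-2 * (n : ℤ) - 2) := by
        rw [← pow_mul, ← zpow_natCast, ← zpow_add₀ hr0]
        congr 1
        push_cast
        ring
      have h2 : r ^ (-2 * (n : ℤ) - 2) * ((r ^ 2) ^ n * r ^ 2) = 1 := by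
        rw [← pow_mul, ← pow_add, ← zpow_natCast, ← zpow_add₀ hr0]
        push_cast
        simp
      rw [show n + 1 + l - 1 - n = l by omega]
      have h3 : (-x) * r ^ (-2 * (n : ℤ) - 2) * (1 - (r ^ 2) ^ n * (r ^ 2 / x)) =
          r ^ (-2 * (n : ℤ) - 2) * ((r ^ 2) ^ n * r ^ 2) - x * r ^ (-2 * (n : ℤ) - 2) := by
        field_simp
        ring
      rw [h3, h2]
      linear_combination (-x) * h1
    have const : ∀ K : ℕ, ∏ n ∈ range K, ((-x) * r ^ (-2 * (n : ℤ) - 2)) =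
        (-x) ^ K * r ^ (-(K : ℤ) ^ 2 - K) := by
      intro K
      induction K with
      | zero => simp
      | succ K ih =>
        rw [prod_range_succ, ih, mul_mul_mul_comm, ← pow_succ, ← zpow_add₀ hr0]
        congr 2
        push_cast
        ring
    rw [← prod_range_reflect, prod_congr rfl step, prod_mul_distrib, const]
  have split : ∏ n ∈ range (2 * N), (1 - (r ^ 2) ^ n * (x * r ^ (-2 * N : ℤ))) =
      (-x) ^ N * r ^ (-(N : ℤ) ^ 2 - N) * (∏ n ∈ range N, (1 - (r ^ 2) ^ n * (r ^ 2 / x))) *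
        ∏ n ∈ range N, (1 - (r ^ 2) ^ n * x) := by
    rw [two_mul, prod_range_add, refl]
    congr 1
    refine prod_congr rfl fun n _ => ?_
    have : (r ^ 2) ^ N * r ^ (-2 * N : ℤ) = 1 := by
      rw [← zpow_natCast, ← zpow_natCast, ← zpow_mul, ← zpow_add₀ hr0]
      simp
    rw [pow_add]
    linear_combination (-(r ^ 2) ^ n * x) * this
  have hne : (-x) ^ N * r ^ (-(N : ℤ) ^ 2 - N) ≠ 0 :=
    mul_ne_zero (pow_ne_zero _ (neg_ne_zero.mpr hx)) (zpow_ne_zero _ hr0)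
  rw [split] at hz
  refine mul_left_cancel₀ hne ?_
  rw [mul_comm (∏ n ∈ range N, (1 - (r ^ 2) ^ n * x)), ← mul_assoc, hz, mul_sum]
  refine sum_bij (fun k _ => (k : ℤ) - N) ?_ ?_ ?_ ?_
  · intro k hk
    simp at hk ⊢
    omega
  · intro a _ b _ h
    simpa using h
  · intro j hj
    simp at hj
    exact ⟨(j + N).toNat, by simp; omega, by omega⟩
  · intro k hk
    simp at hk
    rw [show ((N : ℤ) + (k - N)).toNat = k by omega,
      show ((N : ℤ) - (k - N)).toNat = 2 * N - k by omega]
    have hx' : (-x) ^ N = (-1) ^ (N : ℤ) * x ^ (N : ℤ) := by rw [neg_pow]; simp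
    have hxk : x ^ k = x ^ (N : ℤ) * x ^ ((k : ℤ) - N) := by
      rw [← zpow_natCast, ← zpow_add₀ hx]; congr 1; ring
    have hs : (-1 : ℂ) ^ (k : ℤ) = (-1) ^ (N : ℤ) * (-1) ^ ((k : ℤ) - N) := by
      rw [← zpow_add₀ (by norm_num)]; congr 1; ring
    have hrr : r ^ ((k : ℤ) ^ 2 - k) * (r ^ (-2 * N : ℤ)) ^ k =
        r ^ (-(N : ℤ) ^ 2 - N) * r ^ (((k : ℤ) - N) ^ 2 - (k - N)) := by
      rw [← zpow_natCast, ← zpow_mul, ← zpow_add₀ hr0, ← zpow_add₀ hr0]; congr 1; ring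
    unfold thetaCoeff
    rw [mul_pow, hx', hxk, hs]
    linear_combination qFact r (2 * N) / (qFact r k * qFact r (2 * N - k)) *
      ((-1) ^ (N : ℤ) * (-1) ^ ((k : ℤ) - N)) * x ^ (N : ℤ) * x ^ ((k : ℤ) - N) * hrr

/-- The ratio of consecutive terms has norm ‖a‖^(2n+1) ‖b‖, which tends to 0. Negative n reduce to
positive ones with b⁻¹. -/
lemma summable_pow_sq_mul {a b : ℂ} (ha0 : a ≠ 0) (hb : b ≠ 0) (ha : ‖a‖ < 1) :
    Summable fun n : ℤ => ‖a ^ (n ^ 2) * b ^ n‖ := by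
  have key : ∀ b : ℂ, b ≠ 0 → Summable fun n : ℕ => ‖a ^ ((n : ℤ) ^ 2) * b ^ (n : ℤ)‖ := by
    intro b hb
    refine summable_of_ratio_test_tendsto_lt_one zero_lt_one
      (Eventually.of_forall fun n => norm_ne_zero_iff.mpr
        (mul_ne_zero (zpow_ne_zero _ ha0) (zpow_ne_zero _ hb))) ?_
    have h : Tendsto (fun n : ℕ => ‖a‖ ^ n * ‖a‖ ^ n * (‖a‖ * ‖b‖)) atTop (𝓝 (0 * 0 * (‖a‖ * ‖b‖))) := by
      have := tendsto_pow_atTop_nhds_zero_of_lt_one (norm_nonneg a) ha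
      exact (this.mul this).mul_const _
    simp only [zero_mul] at h
    refine h.congr fun n => ?_
    rw [norm_norm, norm_norm, ← norm_div]
    push_cast
    rw [show ((n : ℤ) + 1) ^ 2 = (n : ℤ) ^ 2 + (n + n + 1) by ring, zpow_add₀ ha0, zpow_add₀ ha0,
      zpow_add₀ ha0, zpow_add₀ hb]
    rw [mul_mul_mul_comm (a ^ ((n : ℤ) ^ 2)), mul_div_cancel_left₀ _
        (mul_ne_zero (zpow_ne_zero _ ha0) (zpow_ne_zero _ hb))]
    simp
    ring
  refine Summable.of_nat_of_neg (key b hb) ?_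
  refine (key b⁻¹ (inv_ne_zero hb)).congr fun n => ?_
  simp

lemma summable_thetaCoeff_mul {r x : ℂ} (hr0 : r ≠ 0) (hr : ‖r‖ < 1) (hx : x ≠ 0) :
    Summable fun k : ℤ => ‖thetaCoeff r k * x ^ k‖ := by
  refine (summable_pow_sq_mul hr0 (div_ne_zero hx hr0) hr).congr fun n => ?_
  rw [thetaCoeff, zpow_sub₀ hr0, div_zpow]
  simp
  ring

lemma summable_norm_neg_pow_mul {q : ℂ} (hq : ‖q‖ < 1) (x : ℂ) :
    Summable fun n : ℕ => ‖-(q ^ n * x)‖ := by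
  simp only [norm_neg, norm_mul, norm_pow]
  exact (summable_geometric_of_lt_one (norm_nonneg q) hq).mul_right _

lemma tendsto_prod_qProd {q : ℂ} (hq : ‖q‖ < 1) (x : ℂ) :
    Tendsto (fun N => ∏ n ∈ range N, (1 - q ^ n * x)) atTop (𝓝 (qProd x q)) := by
  have h := (multipliable_one_add_of_summable (summable_norm_neg_pow_mul hq x)).hasProd
  simpa only [← sub_eq_add_neg] using! h.tendsto_prod_nat

lemma qProd_ne_zero {q : ℂ} (hq : ‖q‖ < 1) {x : ℂ} (h : ∀ n : ℕ, q ^ n * x ≠ 1) :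
    qProd x q ≠ 0 := by
  have := tprod_one_add_ne_zero_of_summable (f := fun n : ℕ => -(q ^ n * x))
    (fun n => by rw [← sub_eq_add_neg, sub_ne_zero]; exact (h n).symm)
    (summable_norm_neg_pow_mul hq x)
  simpa only [← sub_eq_add_neg] using! this

lemma qProd_self_ne_zero {q : ℂ} (hq : ‖q‖ < 1) : qProd q q ≠ 0 :=
  qProd_ne_zero hq fun n h => one_sub_pow_ne_zero hq n (by rw [pow_succ, h, sub_self])

lemma tendsto_qFact {r : ℂ} (hr : ‖r‖ < 1) :
    Tendsto (qFact r) atTop (𝓝 (qProd (r ^ 2) (r ^ 2))) := by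
  refine (tendsto_prod_qProd (norm_sq_lt_one hr) (r ^ 2)).congr fun N => ?_
  simp only [qFact, pow_succ]

/-- The Jacobi triple product, for `q = r ^ 2`. -/
theorem qProdPair_eq_tsum {r : ℂ} (hr0 : r ≠ 0) (hr : ‖r‖ < 1) {x : ℂ} (hx : x ≠ 0) :
    qProdPair x (r ^ 2) = (qProd (r ^ 2) (r ^ 2))⁻¹ * ∑' k : ℤ, thetaCoeff r k * x ^ k := by
  have hq := norm_sq_lt_one hr
  have hQ := qProd_self_ne_zero hq
  have ht := tendsto_qFact hr
  -- (q; q)_n converges to a nonzero limit, so it and its inverse are bounded; this dominates the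
  -- finite coefficients uniformly.
  obtain ⟨A, hA⟩ := (Metric.isBounded_range_of_tendsto _ ht).exists_norm_le
  obtain ⟨D, hD⟩ := (Metric.isBounded_range_of_tendsto _ (ht.inv₀ hQ)).exists_norm_le
  have hA' : ∀ n, ‖qFact r n‖ ≤ A := fun n => hA _ ⟨n, rfl⟩
  have hD' : ∀ n, ‖(qFact r n)⁻¹‖ ≤ D := fun n => hD _ ⟨n, rfl⟩
  have hA0 : 0 ≤ A := (norm_nonneg _).trans (hA' 0)
  have hD0 : 0 ≤ D := (norm_nonneg _).trans (hD' 0)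
  -- Extension by zero turns the sums over growing windows into series over ℤ, ready for dominated
  -- convergence.
  let f : ℕ → ℤ → ℂ := fun N j => if j ∈ Icc (-N : ℤ) N then
    qFact r (2 * N) / (qFact r (N + j).toNat * qFact r (N - j).toNat) * thetaCoeff r j * x ^ j
    else 0
  have hlim : Tendsto (fun N => ∑' j, f N j) atTop
      (𝓝 (∑' j : ℤ, (qProd (r ^ 2) (r ^ 2))⁻¹ * (thetaCoeff r j * x ^ j))) := by
    refine tendsto_tsum_of_dominated_convergence
      (bound := fun j => A * (D * D) * ‖thetaCoeff r j * x ^ j‖)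
      ((summable_thetaCoeff_mul hr0 hr hx).mul_left _) ?_ ?_
    · intro j
      have h1 : Tendsto (fun N : ℕ => 2 * N) atTop atTop :=
        tendsto_atTop_mono (fun N => Nat.le_mul_of_pos_left N two_pos) tendsto_id
      have h2 : Tendsto (fun N : ℕ => ((N : ℤ) + j).toNat) atTop atTop :=
        tendsto_atTop_atTop.mpr fun b => ⟨b + j.natAbs, fun a ha => by omega⟩
      have h3 : Tendsto (fun N : ℕ => ((N : ℤ) - j).toNat) atTop atTop :=
        tendsto_atTop_atTop.mpr fun b => ⟨b + j.natAbs, fun a ha => by omega⟩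
      have h4 := ((ht.comp h1).div ((ht.comp h2).mul (ht.comp h3)) (mul_ne_zero hQ hQ)).mul_const
        (thetaCoeff r j * x ^ j)
      rw [show qProd (r ^ 2) (r ^ 2) / (qProd (r ^ 2) (r ^ 2) * qProd (r ^ 2) (r ^ 2)) =
        (qProd (r ^ 2) (r ^ 2))⁻¹ by field_simp] at h4
      refine h4.congr' ?_
      filter_upwards [eventually_ge_atTop j.natAbs] with N hN
      have : j ∈ Icc (-N : ℤ) N := by simp; omega
      simp only [f, if_pos this, Function.comp, Pi.div_apply]
      ring
    · refine Eventually.of_forall fun N j => ?_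
      simp only [f]
      split_ifs
      · rw [mul_assoc, norm_mul, div_eq_mul_inv, mul_inv, norm_mul, norm_mul]
        gcongr
        · exact hA' _
        · exact hD' _
        · exact hD' _
      · rw [norm_zero]
        positivity
  have hT := (tendsto_prod_qProd hq x).mul (tendsto_prod_qProd hq (r ^ 2 / x))
  rw [tsum_mul_left] at hlim
  refine tendsto_nhds_unique hT (hlim.congr fun N => ?_)
  rw [finite_tripleProduct hr0 hr hx, tsum_eq_sum (s := Icc (-N : ℤ) N)]
  · exact sum_congr rfl fun j hj => by simp only [f, if_pos hj]
  · intro j hj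
    simp only [f, if_neg hj]


/-! ### The three-term relation for theta products. -/

/-- The theta series `∑ r ^ (2 n²) x ^ (2 n)`. -/
def thetaEven (r x : ℂ) : ℂ := ∑' n : ℤ, (r ^ 2) ^ (n ^ 2) * (x ^ 2) ^ n

/-- The theta series `∑ r ^ (2 n² - 2 n) x ^ (2 n)`. -/
def thetaOdd (r x : ℂ) : ℂ := ∑' n : ℤ, (r ^ 2) ^ (n ^ 2) * ((x / r) ^ 2) ^ n

/-- The two parity classes of pairs of integers. -/
def parityMap : (ℤ × ℤ) ⊕ (ℤ × ℤ) → ℤ × ℤ :=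
  Sum.elim (fun a => (a.1 + a.2, a.1 - a.2)) (fun a => (a.1 + a.2, a.1 - a.2 + 1))

lemma parityMap_bijective : Function.Bijective parityMap := by
  constructor
  · rintro (⟨a, b⟩ | ⟨a, b⟩) (⟨c, d⟩ | ⟨c, d⟩) h <;>
      simp [parityMap] at h ⊢ <;> omega
  · rintro ⟨m, n⟩
    rcases Int.even_or_odd' (m + n) with ⟨s, hs | hs⟩
    · exact ⟨.inl (s, m - s), by simp [parityMap]; omega⟩
    · exact ⟨.inr (s, m - s), by simp [parityMap]; omega⟩

/-- The product of theta series at `x y` and `x / y` splits by parity. -/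
theorem tsum_theta_mul_tsum_theta {r : ℂ} (hr0 : r ≠ 0) (hr : ‖r‖ < 1) {x y : ℂ} (hx : x ≠ 0)
    (hy : y ≠ 0) :
    (∑' k : ℤ, thetaCoeff r k * (x * y) ^ k) * (∑' k : ℤ, thetaCoeff r k * (x / y) ^ k) =
      thetaOdd r x * thetaEven r y - x / y * (thetaEven r x * thetaOdd r y) := by
  have hr2 := norm_sq_lt_one hr
  have hr20 : r ^ 2 ≠ 0 := pow_ne_zero 2 hr0
  have hxy : x * y ≠ 0 := mul_ne_zero hx hy
  have hxdy : x / y ≠ 0 := div_ne_zero hx hy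
  have se : ∀ {z : ℂ}, z ≠ 0 → Summable fun n : ℤ => ‖(r ^ 2) ^ (n ^ 2) * (z ^ 2) ^ n‖ :=
    fun hz => summable_pow_sq_mul hr20 (pow_ne_zero 2 hz) hr2
  have hxr := div_ne_zero hx hr0
  have hyr := div_ne_zero hy hr0
  have s1 := summable_thetaCoeff_mul hr0 hr hxy
  have s2 := summable_thetaCoeff_mul hr0 hr hxdy
  rw [tsum_mul_tsum_of_summable_norm s1 s2,
    ← (Equiv.ofBijective parityMap parityMap_bijective).tsum_eq]
  have hs := (summable_mul_of_summable_norm s1 s2)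
  rw [← (Equiv.ofBijective parityMap parityMap_bijective).summable_iff] at hs
  erw [Summable.tsum_sum (hs.comp_injective Sum.inl_injective)
    (hs.comp_injective Sum.inr_injective), sub_eq_add_neg]
  congr 1
  · rw [thetaOdd, thetaEven, tsum_mul_tsum_of_summable_norm (se hxr) (se hy)]
    refine tsum_congr fun ⟨a, b⟩ => ?_
    simp only [Function.comp, Equiv.ofBijective_apply, parityMap, Sum.elim_inl, thetaCoeff]
    have hsgn : (-1 : ℂ) ^ (a + b) * (-1) ^ (a - b) = 1 := by
      rw [← zpow_add₀ (by norm_num), show a + b + (a - b) = 2 * a by ring, zpow_mul]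
      norm_num
    have hrr : r ^ ((a + b) ^ 2 - (a + b)) * r ^ ((a - b) ^ 2 - (a - b)) =
        (r ^ 2) ^ (a ^ 2) * (r ^ 2) ^ (b ^ 2) * ((r ^ 2) ^ a)⁻¹ := by
      rw [← zpow_neg, ← zpow_natCast, ← zpow_mul, ← zpow_mul, ← zpow_mul, ← zpow_add₀ hr0,
        ← zpow_add₀ hr0, ← zpow_add₀ hr0]
      congr 1
      push_cast
      ring
    have hxx : x ^ (a + b) * x ^ (a - b) = (x ^ 2) ^ a := by
      rw [← zpow_natCast, ← zpow_mul, ← zpow_add₀ hx]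
      congr 1
      push_cast
      ring
    have hyy : y ^ (a + b) * (y ^ (a - b))⁻¹ = (y ^ 2) ^ b := by
      rw [← zpow_neg, ← zpow_natCast, ← zpow_mul, ← zpow_add₀ hy]
      congr 1
      push_cast
      ring
    rw [mul_zpow, div_zpow, div_pow, div_zpow, ← hxx, ← hyy]
    linear_combination (x ^ (a + b) * x ^ (a - b) * (y ^ (a + b) * (y ^ (a - b))⁻¹)) *
      (r ^ ((a + b) ^ 2 - (a + b)) * r ^ ((a - b) ^ 2 - (a - b)) * hsgn + hrr)
  · rw [thetaOdd, thetaEven, tsum_mul_tsum_of_summable_norm (se hx) (se hyr), ← tsum_mul_left,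
      ← tsum_neg]
    refine tsum_congr fun ⟨a, b⟩ => ?_
    simp only [Function.comp, Equiv.ofBijective_apply, parityMap, Sum.elim_inr, thetaCoeff]
    have hsgn : (-1 : ℂ) ^ (a + b) * (-1) ^ (a - b + 1) = -1 := by
      rw [← zpow_add₀ (by norm_num), show a + b + (a - b + 1) = 2 * a + 1 by ring,
        zpow_add₀ (by norm_num), zpow_mul]
      norm_num
    have hrr : r ^ ((a + b) ^ 2 - (a + b)) * r ^ ((a - b + 1) ^ 2 - (a - b + 1)) =
        (r ^ 2) ^ (a ^ 2) * (r ^ 2) ^ (b ^ 2) * ((r ^ 2) ^ b)⁻¹ := by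
      rw [← zpow_neg, ← zpow_natCast, ← zpow_mul, ← zpow_mul, ← zpow_mul, ← zpow_add₀ hr0,
        ← zpow_add₀ hr0, ← zpow_add₀ hr0]
      congr 1
      push_cast
      ring
    have hxx : x ^ (a + b) * x ^ (a - b + 1) = x * (x ^ 2) ^ a := by
      rw [← zpow_natCast, ← zpow_mul, ← zpow_add₀ hx, ← zpow_one_add₀ hx]
      congr 1
      push_cast
      ring
    have hyy : y ^ (a + b) * (y ^ (a - b + 1))⁻¹ = y⁻¹ * (y ^ 2) ^ b := by
      rw [← zpow_neg, ← zpow_natCast, ← zpow_mul, ← zpow_add₀ hy, ← zpow_neg_one,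
        ← zpow_add₀ hy]
      congr 1
      push_cast
      ring
    rw [mul_zpow, div_zpow, div_pow, div_zpow]
    linear_combination (x ^ (a + b) * x ^ (a - b + 1) * (y ^ (a + b) * (y ^ (a - b + 1))⁻¹)) *
      (r ^ ((a + b) ^ 2 - (a + b)) * r ^ ((a - b + 1) ^ 2 - (a - b + 1)) * hsgn - hrr) -
      (r ^ 2) ^ (a ^ 2) * (r ^ 2) ^ (b ^ 2) * ((r ^ 2) ^ b)⁻¹ * (hxx *
      (y ^ (a + b) * (y ^ (a - b + 1))⁻¹) + x * (x ^ 2) ^ a * hyy)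

lemma exists_sq_eq_of_norm_lt_one {q : ℂ} (hq0 : q ≠ 0) (hq : ‖q‖ < 1) :
    ∃ r : ℂ, r ≠ 0 ∧ ‖r‖ < 1 ∧ q = r ^ 2 := by
  obtain ⟨r, rfl⟩ := IsAlgClosed.exists_pow_nat_eq q two_pos
  refine ⟨r, fun h => hq0 (by simp [h]), ?_, rfl⟩
  rw [norm_pow] at hq
  by_contra! h
  exact absurd hq (not_lt.mpr (one_le_pow₀ h))

/-- The three-term (Weierstrass) relation for theta products. -/
theorem qProdPair_three_term {q : ℂ} (hq0 : q ≠ 0) (hq : ‖q‖ < 1) {x y u v : ℂ} (hx : x ≠ 0)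
    (hy : y ≠ 0) (hu : u ≠ 0) (hv : v ≠ 0) :
    qProdPair (x * y) q * qProdPair (x / y) q * (qProdPair (u * v) q * qProdPair (u / v) q) -
      qProdPair (x * v) q * qProdPair (x / v) q * (qProdPair (u * y) q * qProdPair (u / y) q) =
      u / y * (qProdPair (y * v) q * qProdPair (y / v) q *
        (qProdPair (x * u) q * qProdPair (x / u) q)) := by
  obtain ⟨r, hr0, hr, rfl⟩ := exists_sq_eq_of_norm_lt_one hq0 hq
  -- Multiplied by w, the right side is the determinant of (O(z), z E(z)) and (O(w), w E(w)), with
  -- O, E the odd and even theta series; the goal becomes a Plücker relation.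
  have key : ∀ {z w : ℂ}, z ≠ 0 → w ≠ 0 →
      qProdPair (z * w) (r ^ 2) * qProdPair (z / w) (r ^ 2) = (qProd (r ^ 2) (r ^ 2))⁻¹ ^ 2 *
        (thetaOdd r z * thetaEven r w - z / w * (thetaEven r z * thetaOdd r w)) := by
    intro z w hz hw
    rw [← tsum_theta_mul_tsum_theta hr0 hr hz hw, qProdPair_eq_tsum hr0 hr (mul_ne_zero hz hw),
      qProdPair_eq_tsum hr0 hr (div_ne_zero hz hw)]
    ring
  rw [key hx hy, key hu hv, key hx hv, key hu hy, key hy hv, key hx hu]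
  field_simp
  ring


/-! ### Functional equations, splittings and non-vanishing of the products. -/

lemma qProd_eq_one_sub_mul {q : ℂ} (hq : ‖q‖ < 1) (x : ℂ) :
    qProd x q = (1 - x) * qProd (q * x) q := by
  refine tendsto_nhds_unique ((tendsto_add_atTop_iff_nat 1).mpr (tendsto_prod_qProd hq x)) ?_
  refine ((tendsto_prod_qProd hq (q * x)).const_mul (1 - x)).congr fun N => ?_
  rw [prod_range_succ', mul_comm]
  simp [pow_succ, mul_assoc]

lemma qProdPair_div {q : ℂ} (hq0 : q ≠ 0) (x : ℂ) :
    qProdPair (q / x) q = qProdPair x q := by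
  rw [qProdPair, qProdPair, div_div_cancel₀ hq0, mul_comm]

lemma qProdPair_inv {q : ℂ} (hq : ‖q‖ < 1) {x : ℂ} (hx : x ≠ 0) :
    qProdPair x⁻¹ q = -x⁻¹ * qProdPair x q := by
  rw [qProdPair, qProdPair, qProd_eq_one_sub_mul hq x⁻¹, qProd_eq_one_sub_mul hq x, div_inv_eq_mul,
    div_eq_mul_inv]
  field_simp
  ring

lemma qProdPair_mul {q : ℂ} (hq0 : q ≠ 0) (hq : ‖q‖ < 1) {x : ℂ} (hx : x ≠ 0) :
    qProdPair (q * x) q = -x⁻¹ * qProdPair x q := by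
  rw [← qProdPair_inv hq hx, ← qProdPair_div hq0 x⁻¹, div_inv_eq_mul]

lemma qProd_sq {q : ℂ} (hq : ‖q‖ < 1) (x : ℂ) :
    qProd (x ^ 2) (q ^ 2) = qProd x q * qProd (-x) q := by
  refine tendsto_nhds_unique (tendsto_prod_qProd (norm_sq_lt_one hq) (x ^ 2)) ?_
  refine ((tendsto_prod_qProd hq x).mul (tendsto_prod_qProd hq (-x))).congr fun N => ?_
  rw [← prod_mul_distrib]
  exact prod_congr rfl fun n _ => by ring

/-- Splitting the product by residue classes of the exponent. -/
lemma qProd_eq_prod_range {q : ℂ} (hq : ‖q‖ < 1) (x : ℂ) {k : ℕ} (hk : 0 < k) :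
    qProd x q = ∏ j ∈ range k, qProd (q ^ j * x) (q ^ k) := by
  have hqk : ‖q ^ k‖ < 1 := by
    rw [norm_pow]
    exact pow_lt_one₀ (norm_nonneg _) hq hk.ne'
  have h1 : Tendsto (fun N => k * N) atTop atTop :=
    tendsto_atTop_mono (fun N => Nat.le_mul_of_pos_left N hk) tendsto_id
  -- Partial products of length k N contain exactly N factors from each residue class.
  refine tendsto_nhds_unique ((tendsto_prod_qProd hq x).comp h1) ?_
  refine (tendsto_finsetProd (range k) fun j _ => tendsto_prod_qProd hqk (q ^ j * x)).congr
    fun N => ?_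
  rw [Finset.prod_comm]
  induction N with
  | zero => simp
  | succ N ih =>
    simp only [Function.comp] at ih ⊢
    rw [prod_range_succ, ih, mul_add, mul_one, prod_range_add]
    congr 1
    exact prod_congr rfl fun j _ => by ring

lemma qProdPair_sq {q : ℂ} (hq : ‖q‖ < 1) (x : ℂ) :
    qProdPair (x ^ 2) (q ^ 2) = qProdPair x q * qProdPair (-x) q := by
  rw [qProdPair, qProdPair, qProdPair, ← div_pow, qProd_sq hq, qProd_sq hq, div_neg]
  ring

lemma qProdPair_eq_mul {q : ℂ} (hq0 : q ≠ 0) (hq : ‖q‖ < 1) (x : ℂ) :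
    qProdPair x q = qProdPair x (q ^ 2) * qProdPair (q / x) (q ^ 2) := by
  have h1 := qProd_eq_prod_range hq x (k := 2) (by norm_num)
  have h2 := qProd_eq_prod_range hq (q / x) (k := 2) (by norm_num)
  rw [prod_range_succ, prod_range_one, pow_zero, one_mul, pow_one] at h1 h2
  rw [qProdPair, qProdPair, qProdPair, h1, h2, show q ^ 2 / x = q * (q / x) by ring,
    show q ^ 2 / (q / x) = q * x by field_simp]
  ring

lemma qProd_ne_zero_of_norm_lt_one {q x : ℂ} (hq : ‖q‖ < 1) (hx : ‖x‖ < 1) : qProd x q ≠ 0 := by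
  refine qProd_ne_zero hq fun n h => ?_
  have : ‖q ^ n * x‖ < 1 := by
    rw [norm_mul, norm_pow]
    exact (mul_le_of_le_one_left (norm_nonneg _)
      (pow_le_one₀ (norm_nonneg _) hq.le)).trans_lt hx
  rw [h, norm_one] at this
  exact lt_irrefl _ this

lemma norm_pow_lt_one {q : ℂ} (hq : ‖q‖ < 1) {k : ℕ} (hk : k ≠ 0) : ‖q ^ k‖ < 1 := by
  rw [norm_pow]
  exact pow_lt_one₀ (norm_nonneg _) hq hk

lemma qProdPair_pow_ne_zero {q : ℂ} (hq0 : q ≠ 0) (hq : ‖q‖ < 1) {k l : ℕ} (hk : 0 < k)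
    (hl : k < l) : qProdPair (q ^ k) (q ^ l) ≠ 0 := by
  have hql := norm_pow_lt_one hq (k := l) (by omega)
  refine mul_ne_zero (qProd_ne_zero_of_norm_lt_one hql (norm_pow_lt_one hq hk.ne'))
    (qProd_ne_zero_of_norm_lt_one hql ?_)
  rw [div_eq_mul_inv, ← pow_sub₀ q hq0 hl.le]
  exact norm_pow_lt_one hq (by omega)

lemma qProdPair_neg_pow_ne_zero {q : ℂ} (hq0 : q ≠ 0) (hq : ‖q‖ < 1) {k l : ℕ} (hk : 0 < k)
    (hl : k < l) : qProdPair (-q ^ k) (q ^ l) ≠ 0 := by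
  have hql := norm_pow_lt_one hq (k := l) (by omega)
  refine mul_ne_zero (qProd_ne_zero_of_norm_lt_one hql ?_)
    (qProd_ne_zero_of_norm_lt_one hql ?_)
  · rw [norm_neg]
    exact norm_pow_lt_one hq hk.ne'
  · rw [div_neg, norm_neg, div_eq_mul_inv, ← pow_sub₀ q hq0 hl.le]
    exact norm_pow_lt_one hq (by omega)

lemma qProdPair_pow_reflect {q : ℂ} (hq0 : q ≠ 0) {k l m : ℕ} (h : k + m = l) :
    qProdPair (q ^ k) (q ^ l) = qProdPair (q ^ m) (q ^ l) := by
  rw [← qProdPair_div (pow_ne_zero l hq0), ← h, pow_add,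
    mul_div_cancel_left₀ _ (pow_ne_zero k hq0)]

lemma qProdPair_neg_pow_reflect {q : ℂ} (hq0 : q ≠ 0) {k l m : ℕ} (h : k + m = l) :
    qProdPair (-q ^ k) (q ^ l) = qProdPair (-q ^ m) (q ^ l) := by
  rw [← qProdPair_div (pow_ne_zero l hq0), ← h, pow_add, div_neg,
    mul_div_cancel_left₀ _ (pow_ne_zero k hq0)]

/-! ### Theta relations of levels 7 and 14. -/

/-- The theta relation of level `7` behind the coefficient of `X ^ 2`. -/
theorem theta_relation_seven {q : ℂ} (hq0 : q ≠ 0) (hq : ‖q‖ < 1) :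
    q * qProdPair q (q ^ 7) ^ 2 * qProdPair (-q) (q ^ 7) * qProdPair (q ^ 2) (q ^ 7) +
      qProdPair (q ^ 2) (q ^ 7) ^ 2 * qProdPair (-q ^ 2) (q ^ 7) * qProdPair (q ^ 3) (q ^ 7) -
      qProdPair (q ^ 3) (q ^ 7) ^ 2 * qProdPair (-q ^ 3) (q ^ 7) * qProdPair q (q ^ 7) =
    q * qProdPair (-1) (q ^ 7) * qProdPair q (q ^ 7) * qProdPair (q ^ 2) (q ^ 7) *
      qProdPair (q ^ 3) (q ^ 7) := by
  have h7 := norm_pow_lt_one hq (k := 7) (by norm_num)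
  have h70 : q ^ 7 ≠ 0 := pow_ne_zero 7 hq0
  have i : ∀ k : ℕ, qProdPair (q ^ k)⁻¹ (q ^ 7) = -(q ^ k)⁻¹ * qProdPair (q ^ k) (q ^ 7) :=
    fun k => qProdPair_inv h7 (pow_ne_zero k hq0)
  have j : ∀ k : ℕ, qProdPair (-(q ^ k)⁻¹) (q ^ 7) = (q ^ k)⁻¹ * qProdPair (-q ^ k) (q ^ 7) := by
    intro k
    have := qProdPair_inv h7 (neg_ne_zero.mpr (pow_ne_zero k hq0))
    rwa [inv_neg, neg_neg] at this
  have i1 := i 1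
  have j1 := j 1
  have c5 := qProdPair_pow_reflect hq0 (show 5 + 2 = 7 by norm_num)
  have c4 := qProdPair_pow_reflect hq0 (show 4 + 3 = 7 by norm_num)
  have d6 := qProdPair_neg_pow_reflect hq0 (show 6 + 1 = 7 by norm_num)
  have d5 := qProdPair_neg_pow_reflect hq0 (show 5 + 2 = 7 by norm_num)
  have d4 := qProdPair_neg_pow_reflect hq0 (show 4 + 3 = 7 by norm_num)
  have n1 := qProdPair_neg_pow_ne_zero hq0 hq (k := 1) (l := 7) (by norm_num) (by norm_num)
  have R1 := qProdPair_three_term h70 h7 (x := 1) (y := -q) (u := q ^ 2) (v := q ^ 3)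
    one_ne_zero (neg_ne_zero.mpr hq0) (pow_ne_zero 2 hq0) (pow_ne_zero 3 hq0)
  have R2 := qProdPair_three_term h70 h7 (x := q) (y := q ^ 2) (u := q ^ 3) (v := -q ^ 3)
    hq0 (pow_ne_zero 2 hq0) (pow_ne_zero 3 hq0) (neg_ne_zero.mpr (pow_ne_zero 3 hq0))
  simp only [pow_one] at *
  rw [show 1 * -q = -q by ring, show 1 / -q = -q⁻¹ by field_simp, show q ^ 2 * q ^ 3 = q ^ 5 by ring,
    show q ^ 2 / q ^ 3 = q⁻¹ by field_simp, show 1 * q ^ 3 = q ^ 3 by ring,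
    show 1 / q ^ 3 = (q ^ 3)⁻¹ by field_simp, show q ^ 2 * -q = -q ^ 3 by ring,
    show q ^ 2 / -q = -q by field_simp, show -q * q ^ 3 = -q ^ 4 by ring,
    show -q / q ^ 3 = -(q ^ 2)⁻¹ by field_simp, show 1 * q ^ 2 = q ^ 2 by ring,
    show 1 / q ^ 2 = (q ^ 2)⁻¹ by field_simp, i1, j1, i 3, i 2, j 2, c5, d4] at R1
  rw [show q * q ^ 2 = q ^ 3 by ring, show q / q ^ 2 = q⁻¹ by field_simp,
    show q ^ 3 * -q ^ 3 = -q ^ 6 by ring, show q ^ 3 / -q ^ 3 = -1 by field_simp,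
    show q * -q ^ 3 = -q ^ 4 by ring, show q / -q ^ 3 = -(q ^ 2)⁻¹ by field_simp,
    show q ^ 3 * q ^ 2 = q ^ 5 by ring, show q ^ 3 / q ^ 2 = q by field_simp,
    show q ^ 2 * -q ^ 3 = -q ^ 5 by ring, show q ^ 2 / -q ^ 3 = -q⁻¹ by field_simp,
    show q * q ^ 3 = q ^ 4 by ring, show q / q ^ 3 = (q ^ 2)⁻¹ by field_simp,
    i1, j1, i 2, j 2, c5, c4, d4, d5, d6] at R2
  -- After multiplication by n_1, a_1·`R1` and a_2·`R2` share the term a_1 a_2² n_2 n_3, whose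
  -- elimination leaves the claim.
  refine mul_left_cancel₀ n1 ?_
  field_simp at R1 R2
  linear_combination (-qProdPair q (q ^ 7)) * R1 + (qProdPair (q ^ 2) (q ^ 7)) * R2

/-- The theta relation of level `14` behind the coefficient of `X`. -/
theorem theta_relation_fourteen {q : ℂ} (hq0 : q ≠ 0) (hq : ‖q‖ < 1) :
    qProdPair (q ^ 3) (q ^ 14) * qProdPair (q ^ 4) (q ^ 14) ^ 2 * qProdPair (q ^ 6) (q ^ 14) +
      q * qProdPair q (q ^ 14) * qProdPair (q ^ 6) (q ^ 14) ^ 2 * qProdPair (q ^ 2) (q ^ 14) -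
      q * qProdPair (q ^ 2) (q ^ 14) ^ 2 * qProdPair (q ^ 5) (q ^ 14) *
        qProdPair (q ^ 4) (q ^ 14) =
    qProdPair (q ^ 2) (q ^ 14) * qProdPair (q ^ 4) (q ^ 14) * qProdPair (q ^ 6) (q ^ 14) *
      qProdPair (q ^ 7) (q ^ 14) := by
  have h14 := norm_pow_lt_one hq (k := 14) (by norm_num)
  have h140 : q ^ 14 ≠ 0 := pow_ne_zero 14 hq0
  have i : ∀ k : ℕ, qProdPair (q ^ k)⁻¹ (q ^ 14) = -(q ^ k)⁻¹ * qProdPair (q ^ k) (q ^ 14) :=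
    fun k => qProdPair_inv h14 (pow_ne_zero k hq0)
  have i1 := i 1
  have c9 := qProdPair_pow_reflect hq0 (show 9 + 5 = 14 by norm_num)
  have c8 := qProdPair_pow_reflect hq0 (show 8 + 6 = 14 by norm_num)
  have n1 := qProdPair_pow_ne_zero hq0 hq (k := 1) (l := 14) (by norm_num) (by norm_num)
  have R1 := qProdPair_three_term h140 h14 (x := 1) (y := q) (u := q ^ 2) (v := q ^ 4)
    one_ne_zero hq0 (pow_ne_zero 2 hq0) (pow_ne_zero 4 hq0)
  have R2 := qProdPair_three_term h140 h14 (x := q) (y := q ^ 3) (u := q ^ 4) (v := q ^ 5)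
    hq0 (pow_ne_zero 3 hq0) (pow_ne_zero 4 hq0) (pow_ne_zero 5 hq0)
  simp only [pow_one] at *
  rw [show 1 * q = q by ring, show 1 / q = q⁻¹ by field_simp, show q ^ 2 * q ^ 4 = q ^ 6 by ring,
    show q ^ 2 / q ^ 4 = (q ^ 2)⁻¹ by field_simp, show 1 * q ^ 4 = q ^ 4 by ring,
    show 1 / q ^ 4 = (q ^ 4)⁻¹ by field_simp, show q ^ 2 * q = q ^ 3 by ring,
    show q ^ 2 / q = q by field_simp, show q * q ^ 4 = q ^ 5 by ring,
    show q / q ^ 4 = (q ^ 3)⁻¹ by field_simp, show 1 * q ^ 2 = q ^ 2 by ring,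
    show 1 / q ^ 2 = (q ^ 2)⁻¹ by field_simp, i1, i 2, i 3, i 4] at R1
  rw [show q * q ^ 3 = q ^ 4 by ring, show q / q ^ 3 = (q ^ 2)⁻¹ by field_simp,
    show q ^ 4 * q ^ 5 = q ^ 9 by ring, show q ^ 4 / q ^ 5 = q⁻¹ by field_simp,
    show q * q ^ 5 = q ^ 6 by ring, show q / q ^ 5 = (q ^ 4)⁻¹ by field_simp,
    show q ^ 4 * q ^ 3 = q ^ 7 by ring, show q ^ 4 / q ^ 3 = q by field_simp,
    show q ^ 3 * q ^ 5 = q ^ 8 by ring, show q ^ 3 / q ^ 5 = (q ^ 2)⁻¹ by field_simp,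
    show q * q ^ 4 = q ^ 5 by ring, show q / q ^ 4 = (q ^ 3)⁻¹ by field_simp,
    i1, i 2, i 3, i 4, c9, c8] at R2
  -- With c_k = ⟨q^k; q^14⟩, the term shared by c_6·`R1` and c_2·`R2` is c_2² c_3 c_5 c_6.
  refine mul_left_cancel₀ n1 ?_
  field_simp at R1 R2
  linear_combination (qProdPair (q ^ 6) (q ^ 14)) * R1 - (qProdPair (q ^ 2) (q ^ 14)) * R2


/-! ### Eta functions as products, and Vieta's formulas. -/

/-- The root `exp (π i τ / 84)` of the nome, `nome τ = etaRoot τ ^ 168`. -/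
def etaRoot (τ : ℂ) : ℂ := Complex.exp (Real.pi * Complex.I * τ / 84)

lemma etaRoot_ne_zero (τ : ℂ) : etaRoot τ ≠ 0 := Complex.exp_ne_zero _

lemma nome_ne_zero (τ : ℂ) : nome τ ≠ 0 := Complex.exp_ne_zero _

lemma nome_eq_etaRoot_pow (τ : ℂ) : nome τ = etaRoot τ ^ 168 := by
  rw [nome, etaRoot, ← Complex.exp_nat_mul]
  congr 1
  push_cast
  ring

lemma norm_nome_lt_one {τ : ℂ} (hτ : 0 < τ.im) : ‖nome τ‖ < 1 := by
  rw [nome, Complex.norm_exp, Real.exp_lt_one_iff]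
  have : (2 * Real.pi * Complex.I * τ).re = -(2 * Real.pi * τ.im) := by simp
  rw [this]
  have := Real.pi_pos
  nlinarith [mul_pos this hτ]

lemma nome_natCast_mul (k : ℕ) (τ : ℂ) : nome (k * τ) = nome τ ^ k := by
  rw [nome, nome, ← Complex.exp_nat_mul]
  congr 1
  ring

lemma etaRoot_natCast_mul (k : ℕ) (τ : ℂ) : etaRoot (k * τ) = etaRoot τ ^ k := by
  rw [etaRoot, etaRoot, ← Complex.exp_nat_mul]
  congr 1
  ring

lemma eta_eq_qProd (τ : ℂ) :
    ModularForm.eta τ = etaRoot τ ^ 7 * qProd (nome τ) (nome τ) := by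
  have h : etaRoot τ ^ 7 = Function.Periodic.qParam 24 τ := by
    rw [etaRoot, Function.Periodic.qParam, ← Complex.exp_nat_mul]
    congr 1
    push_cast
    ring
  rw [ModularForm.eta, h, qProd]
  congr 1
  refine tprod_congr fun n => ?_
  rw [ModularForm.eta_q_eq_pow, pow_succ]
  rfl

lemma eta_natCast_mul (k : ℕ) (τ : ℂ) : ModularForm.eta (k * τ) =
    etaRoot τ ^ (7 * k) * qProd (nome τ ^ k) (nome τ ^ k) := by
  rw [eta_eq_qProd, etaRoot_natCast_mul, nome_natCast_mul, ← pow_mul, mul_comm k]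

lemma E_seven_eq (g : ℤ) (τ : ℂ) :
    E 7 g τ = etaRoot τ ^ (12 * g ^ 2 - 84 * g + 98) * qProdPair (nome τ ^ g) (nome τ ^ 7) := by
  rw [E, etaRoot, ← Complex.exp_int_mul]
  congr 2
  push_cast [B]
  ring

lemma E_seven_two_mul {τ : ℂ} (hτ : 0 < τ.im) (g : ℕ) :
    E 7 g (2 * τ) = etaRoot τ ^ (24 * (g : ℤ) ^ 2 - 168 * g + 196) *
      (qProdPair (nome τ ^ g) (nome τ ^ 7) * qProdPair (-nome τ ^ g) (nome τ ^ 7)) := by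
  have h1 := etaRoot_natCast_mul 2 τ
  have h2 := nome_natCast_mul 2 τ
  push_cast at h1 h2
  rw [E_seven_eq, h1, h2, zpow_natCast, pow_right_comm, pow_right_comm _ 2 7,
    qProdPair_sq (norm_pow_lt_one (norm_nome_lt_one hτ) (by norm_num)), ← zpow_natCast _ 2,
    ← zpow_mul]
  congr 2
  push_cast
  ring

lemma E_seven_ratio_one {τ : ℂ} (hτ : 0 < τ.im) :
    E 7 1 (2 * τ) / E 7 3 τ = etaRoot τ ^ 98 * (qProdPair (nome τ) (nome τ ^ 7) *
      qProdPair (-nome τ) (nome τ ^ 7) / qProdPair (nome τ ^ 3) (nome τ ^ 7)) := by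
  have hw := etaRoot_ne_zero τ
  have h := E_seven_two_mul hτ 1
  push_cast at h
  rw [h, E_seven_eq, pow_one, mul_div_mul_comm, ← zpow_sub₀ hw]
  norm_num

lemma E_seven_ratio_two {τ : ℂ} (hτ : 0 < τ.im) :
    E 7 2 (2 * τ) / E 7 6 τ = (etaRoot τ ^ 70)⁻¹ * (qProdPair (nome τ ^ 2) (nome τ ^ 7) *
      qProdPair (-nome τ ^ 2) (nome τ ^ 7) / qProdPair (nome τ) (nome τ ^ 7)) := by
  have hw := etaRoot_ne_zero τ
  have h := E_seven_two_mul hτ 2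
  have h6 := qProdPair_pow_reflect (nome_ne_zero τ) (show 6 + 1 = 7 by norm_num)
  push_cast at h
  rw [pow_one] at h6
  rw [h, E_seven_eq, show nome τ ^ (6 : ℤ) = nome τ ^ 6 from zpow_natCast _ 6, h6,
    mul_div_mul_comm, ← zpow_sub₀ hw]
  norm_num

lemma E_seven_ratio_three {τ : ℂ} (hτ : 0 < τ.im) :
    E 7 3 (2 * τ) / E 7 9 τ = -(etaRoot τ ^ 70)⁻¹ * (qProdPair (nome τ ^ 3) (nome τ ^ 7) *
      qProdPair (-nome τ ^ 3) (nome τ ^ 7) / qProdPair (nome τ ^ 2) (nome τ ^ 7)) := by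
  have hw := etaRoot_ne_zero τ
  have hq := nome_ne_zero τ
  have h := E_seven_two_mul hτ 3
  have h9 := qProdPair_mul (pow_ne_zero 7 hq)
    (norm_pow_lt_one (norm_nome_lt_one hτ) (by norm_num)) (pow_ne_zero 2 hq)
  rw [← pow_add] at h9
  push_cast at h
  rw [h, E_seven_eq, show nome τ ^ (9 : ℤ) = nome τ ^ (7 + 2) from zpow_natCast _ 9, h9,
    mul_div_mul_comm, ← zpow_sub₀ hw]
  -- The factor q² comes from ⟨q^9; q^7⟩ = -q^(-2) ⟨q^2; q^7⟩.
  have hexp : etaRoot τ ^ (-92 - (12 * (9 : ℤ) ^ 2 - 84 * 9 + 98)) *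
      (etaRoot τ ^ 168) ^ 2 = (etaRoot τ ^ 70)⁻¹ := by
    rw [← pow_mul, ← zpow_natCast, ← zpow_natCast, ← zpow_neg, ← zpow_add₀ hw]
    norm_num
  rw [← hexp, ← nome_eq_etaRoot_pow]
  field_simp

/-- Vieta's formulas for the three theta quotients, from the two theta relations. -/
lemma cubic_eq_prod {a₁ a₂ a₃ n₀ n₁ n₂ n₃ w s t p : ℂ} (ha₁ : a₁ ≠ 0) (ha₂ : a₂ ≠ 0)
    (ha₃ : a₃ ≠ 0) (hw : w ≠ 0) (hn₀ : n₀ ≠ 0)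
    (h1 : w ^ 168 * a₁ ^ 2 * n₁ * a₂ + a₂ ^ 2 * n₂ * a₃ - a₃ ^ 2 * n₃ * a₁ =
      w ^ 168 * n₀ * a₁ * a₂ * a₃)
    (h2 : n₀ * (a₃ * n₂ * n₃ * a₂ * a₃ + w ^ 168 * a₁ * n₁ * n₃ * a₁ * a₃ -
      w ^ 168 * a₂ * n₁ * n₂ * a₁ * a₂) = 2 * (a₁ * a₂ * a₃ * n₁ * n₂ * n₃))
    (hs : s = w ^ 98 * n₀) (hp : w ^ 42 * p = n₁ * n₂ * n₃) (ht : n₀ * t * w ^ 98 = 2 * p) :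
    (Polynomial.X ^ 3 - Polynomial.C s * Polynomial.X ^ 2 - Polynomial.C t * Polynomial.X +
      Polynomial.C p : Polynomial ℂ) =
    (Polynomial.X - Polynomial.C (w ^ 98 * (a₁ * n₁ / a₃))) *
    (Polynomial.X - Polynomial.C ((w ^ 70)⁻¹ * (a₂ * n₂ / a₁))) *
    (Polynomial.X - Polynomial.C (-(w ^ 70)⁻¹ * (a₃ * n₃ / a₂))) := by
  have e1 : s = w ^ 98 * (a₁ * n₁ / a₃) + (w ^ 70)⁻¹ * (a₂ * n₂ / a₁) +
      -(w ^ 70)⁻¹ * (a₃ * n₃ / a₂) := by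
    rw [hs]
    field_simp
    linear_combination -h1
  have e2 : t = -(w ^ 98 * (a₁ * n₁ / a₃) * ((w ^ 70)⁻¹ * (a₂ * n₂ / a₁)) +
      w ^ 98 * (a₁ * n₁ / a₃) * (-(w ^ 70)⁻¹ * (a₃ * n₃ / a₂)) +
      (w ^ 70)⁻¹ * (a₂ * n₂ / a₁) * (-(w ^ 70)⁻¹ * (a₃ * n₃ / a₂))) := by
    refine mul_left_cancel₀ (mul_ne_zero hn₀ (pow_ne_zero 140 hw)) ?_
    have : n₀ * w ^ 140 * t = 2 * (n₁ * n₂ * n₃) := by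
      linear_combination w ^ 42 * ht + 2 * hp
    rw [this]
    field_simp
    linear_combination -h2
  have e3 : p = -(w ^ 98 * (a₁ * n₁ / a₃) * ((w ^ 70)⁻¹ * (a₂ * n₂ / a₁)) *
      (-(w ^ 70)⁻¹ * (a₃ * n₃ / a₂))) := by
    refine mul_left_cancel₀ (pow_ne_zero 42 hw) ?_
    rw [hp]
    field_simp
  rw [e1, e2, e3]
  simp only [map_add, map_mul, map_neg]
  ring


/-! ### Change of level and the eta quotients. -/

lemma qProdPair_level_double {q : ℂ} (hq0 : q ≠ 0) (hq : ‖q‖ < 1) {k l m : ℕ} (h : k + m = l)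
    (hl : l ≠ 0) : qProdPair (q ^ k) (q ^ l) =
      qProdPair (q ^ k) (q ^ (l * 2)) * qProdPair (q ^ m) (q ^ (l * 2)) := by
  rw [qProdPair_eq_mul (pow_ne_zero l hq0) (norm_pow_lt_one hq hl), ← pow_mul]
  congr 2
  rw [← h, pow_add, mul_div_cancel_left₀ _ (pow_ne_zero k hq0)]

lemma qProdPair_neg_one {q : ℂ} (hq : ‖q‖ < 1) :
    qProdPair (-1) q = 2 * qProd (-q) q ^ 2 := by
  rw [qProdPair, qProd_eq_one_sub_mul hq (-1), mul_neg_one, div_neg, div_one]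
  ring

lemma qProd_sq_self {q : ℂ} (hq : ‖q‖ < 1) :
    qProd (q ^ 2) (q ^ 2) = qProd q q * qProd (-q) q := qProd_sq hq q

/-- Euler's identity `(q; q²) (-q; q) = 1`. -/
lemma qProd_odd_mul_qProd_neg {q : ℂ} (hq : ‖q‖ < 1) : qProd q (q ^ 2) * qProd (-q) q = 1 := by
  have h := qProd_eq_prod_range hq q (k := 2) (by norm_num)
  rw [prod_range_succ, prod_range_one, pow_zero, one_mul, pow_one, ← pow_two,
    qProd_sq_self hq] at h
  refine mul_left_cancel₀ (qProd_self_ne_zero hq) ?_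
  linear_combination -h

lemma qProdPair_neg_one_mul_self {q : ℂ} (hq0 : q ≠ 0) (hq : ‖q‖ < 1) :
    qProdPair (-1) q * qProdPair q (q ^ 2) = 2 := by
  have h := qProd_odd_mul_qProd_neg hq
  rw [qProdPair_neg_one hq, qProdPair, show q ^ 2 / q = q by field_simp]
  linear_combination 2 * (qProd q (q ^ 2) * qProd (-q) q + 1) * h

/-- Exponents modulo 7 pair up as k and 7 - k; the multiples of 7 give the unpaired factor. -/
lemma qProd_neg_eq_seven {q : ℂ} (hq0 : q ≠ 0) (hq : ‖q‖ < 1) :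
    qProd (-q) q = qProdPair (-q) (q ^ 7) * qProdPair (-q ^ 2) (q ^ 7) *
      qProdPair (-q ^ 3) (q ^ 7) * qProd (-q ^ 7) (q ^ 7) := by
  rw [qProd_eq_prod_range hq (-q) (k := 7) (by norm_num)]
  simp only [prod_range_succ, prod_range_zero, qProdPair, pow_zero, one_mul]
  rw [show q ^ 7 / -q = q ^ 5 * -q by field_simp, show q ^ 7 / -q ^ 2 = q ^ 4 * -q by field_simp,
    show q ^ 7 / -q ^ 3 = q ^ 3 * -q by field_simp, show -q ^ 2 = q ^ 1 * -q by ring,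
    show -q ^ 3 = q ^ 2 * -q by ring, show -q ^ 7 = q ^ 6 * -q by ring]
  ring

/-- The theta relation of level `14`, rewritten with theta products of level `7`. -/
theorem theta_relation_seven_inv {q : ℂ} (hq0 : q ≠ 0) (hq : ‖q‖ < 1) :
    qProdPair (-1) (q ^ 7) * (qProdPair (q ^ 3) (q ^ 7) * qProdPair (-q ^ 2) (q ^ 7) *
        qProdPair (-q ^ 3) (q ^ 7) * qProdPair (q ^ 2) (q ^ 7) * qProdPair (q ^ 3) (q ^ 7) +
      q * qProdPair q (q ^ 7) * qProdPair (-q) (q ^ 7) * qProdPair (-q ^ 3) (q ^ 7) *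
        qProdPair q (q ^ 7) * qProdPair (q ^ 3) (q ^ 7) -
      q * qProdPair (q ^ 2) (q ^ 7) * qProdPair (-q) (q ^ 7) * qProdPair (-q ^ 2) (q ^ 7) *
        qProdPair q (q ^ 7) * qProdPair (q ^ 2) (q ^ 7)) =
    2 * (qProdPair q (q ^ 7) * qProdPair (q ^ 2) (q ^ 7) * qProdPair (q ^ 3) (q ^ 7) *
      qProdPair (-q) (q ^ 7) * qProdPair (-q ^ 2) (q ^ 7) * qProdPair (-q ^ 3) (q ^ 7)) := by
  have h7 := norm_pow_lt_one hq (k := 7) (by norm_num)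
  have R := theta_relation_fourteen hq0 hq
  have d7 := qProdPair_neg_one_mul_self (pow_ne_zero 7 hq0) h7
  have d (k : ℕ) := qProdPair_sq h7 (q ^ k)
  have b1 := qProdPair_level_double hq0 hq (show 1 + 6 = 7 by norm_num) (by norm_num)
  have b2 := qProdPair_level_double hq0 hq (show 2 + 5 = 7 by norm_num) (by norm_num)
  have b3 := qProdPair_level_double hq0 hq (show 3 + 4 = 7 by norm_num) (by norm_num)
  have d1 := d 1
  have d2 := d 2
  have d3 := d 3
  simp only [← pow_mul, Nat.reduceMul, pow_one] at d1 d2 d3 d7 b1 b2 b3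
  -- Each term on the left of `R` contains a pair with exponents k and 7 - k, which merges to level
  -- 7. The remaining exponents are even, so `d1`, `d2`, `d3` apply.
  have key : qProdPair (q ^ 3) (q ^ 7) * (qProdPair (q ^ 4) (q ^ 14) * qProdPair (q ^ 6) (q ^ 14)) +
      q * qProdPair q (q ^ 7) * (qProdPair (q ^ 2) (q ^ 14) * qProdPair (q ^ 6) (q ^ 14)) -
      q * qProdPair (q ^ 2) (q ^ 7) * (qProdPair (q ^ 2) (q ^ 14) * qProdPair (q ^ 4) (q ^ 14)) =
      qProdPair (q ^ 2) (q ^ 14) * qProdPair (q ^ 4) (q ^ 14) * qProdPair (q ^ 6) (q ^ 14) *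
      qProdPair (q ^ 7) (q ^ 14) := by
    rw [b1, b2, b3]
    linear_combination R
  rw [d1, d2, d3] at key
  linear_combination qProdPair (-1) (q ^ 7) * key +
    qProdPair q (q ^ 7) * qProdPair (-q) (q ^ 7) * (qProdPair (q ^ 2) (q ^ 7) *
      qProdPair (-q ^ 2) (q ^ 7)) * (qProdPair (q ^ 3) (q ^ 7) * qProdPair (-q ^ 3) (q ^ 7)) * d7

/-- Here η(14τ)/η(7τ) = w^49 (-q^7; q^7), and ⟨-1; q^7⟩ contributes the factor 2. -/
lemma eta_quotient_sq {τ : ℂ} (hτ : 0 < τ.im) :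
    2 * (ModularForm.eta (14 * τ) ^ 2 / ModularForm.eta (7 * τ) ^ 2) =
      etaRoot τ ^ 98 * qProdPair (-1) (nome τ ^ 7) := by
  have h7 := norm_pow_lt_one (norm_nome_lt_one hτ) (k := 7) (by norm_num)
  have e7 := eta_natCast_mul 7 τ
  have e14 := eta_natCast_mul 14 τ
  rw [show nome τ ^ 14 = (nome τ ^ 7) ^ 2 by ring, qProd_sq_self h7] at e14
  push_cast at e7 e14
  have hP := qProd_self_ne_zero h7
  have hw := etaRoot_ne_zero τ
  rw [e7, e14, qProdPair_neg_one h7]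
  field_simp

lemma eta_quotient_eq_qProdPair {τ : ℂ} (hτ : 0 < τ.im) :
    etaRoot τ ^ 42 * (ModularForm.eta (2 * τ) * ModularForm.eta (7 * τ) /
      (ModularForm.eta τ * ModularForm.eta (14 * τ))) =
    qProdPair (-nome τ) (nome τ ^ 7) * qProdPair (-nome τ ^ 2) (nome τ ^ 7) *
      qProdPair (-nome τ ^ 3) (nome τ ^ 7) := by
  have hq := norm_nome_lt_one hτ
  have h7 := norm_pow_lt_one hq (k := 7) (by norm_num)
  have e2 := eta_natCast_mul 2 τ
  have e7 := eta_natCast_mul 7 τ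
  have e14 := eta_natCast_mul 14 τ
  rw [show nome τ ^ 14 = (nome τ ^ 7) ^ 2 by ring, qProd_sq_self h7] at e14
  rw [qProd_sq_self hq, qProd_neg_eq_seven (nome_ne_zero τ) hq] at e2
  push_cast at e2 e7 e14
  have hP := qProd_self_ne_zero h7
  have hP1 := qProd_self_ne_zero hq
  have hN : qProd (-nome τ ^ 7) (nome τ ^ 7) ≠ 0 :=
    qProd_ne_zero_of_norm_lt_one h7 (by rwa [norm_neg])
  have hw := etaRoot_ne_zero τ
  rw [e2, e7, e14, eta_eq_qProd]
  field_simp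

end GenEta

end

/-! ### The cubic identity. -/

theorem corollary1p5 (τ : ℂ) (hτ : 0 < τ.im) :
    (Polynomial.X ^ 3
      - Polynomial.C (2 * (ModularForm.eta (14 * τ) ^ 2 / ModularForm.eta (7 * τ) ^ 2)) *
          Polynomial.X ^ 2
      - Polynomial.C (ModularForm.eta (2 * τ) * ModularForm.eta (7 * τ) ^ 3 /
          (ModularForm.eta τ * ModularForm.eta (14 * τ) ^ 3)) * Polynomial.X
      + Polynomial.C (ModularForm.eta (2 * τ) * ModularForm.eta (7 * τ) /
          (ModularForm.eta τ * ModularForm.eta (14 * τ))) : Polynomial ℂ)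
    = ∏ g ∈ Finset.Icc (1 : ℤ) 3,
        (Polynomial.X - Polynomial.C (GenEta.E 7 g (2 * τ) / GenEta.E 7 (3 * g) τ)) := by
  have hq0 := GenEta.nome_ne_zero τ
  have hq := GenEta.norm_nome_lt_one hτ
  have hs := GenEta.eta_quotient_sq hτ
  -- Its product with ⟨q^7; q^14⟩ is 2.
  have hn : GenEta.qProdPair (-1) (GenEta.nome τ ^ 7) ≠ 0 := by
    intro h
    have := GenEta.qProdPair_neg_one_mul_self (pow_ne_zero 7 hq0)
      (GenEta.norm_pow_lt_one hq (by norm_num))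
    rw [h, zero_mul] at this
    norm_num at this
  have ha (k : ℕ) (hk : 0 < k) (hk' : k < 7) :=
    GenEta.qProdPair_pow_ne_zero hq0 hq hk hk'
  have ha1 := ha 1 (by norm_num) (by norm_num)
  rw [pow_one] at ha1
  have h1 := GenEta.theta_relation_seven hq0 hq
  have h2 := GenEta.theta_relation_seven_inv hq0 hq
  have hη (k : ℕ) (hk : 0 < k) : ModularForm.eta (k * τ) ≠ 0 :=
    ModularForm.eta_ne_zero (by simpa using! mul_pos (Nat.cast_pos.mpr hk) hτ)
  have h7 := hη 7 (by norm_num)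
  have h14 := hη 14 (by norm_num)
  have hη1 := hη 1 (by norm_num)
  push_cast at h7 h14 hη1
  rw [one_mul] at hη1
  have hIcc : Finset.Icc (1 : ℤ) 3 = {1, 2, 3} := rfl
  rw [hIcc, Finset.prod_insert (by norm_num), Finset.prod_pair (by norm_num), ← mul_assoc]
  norm_num only
  rw [GenEta.E_seven_ratio_one hτ, GenEta.E_seven_ratio_two hτ, GenEta.E_seven_ratio_three hτ]
  refine GenEta.cubic_eq_prod ha1 (ha 2 (by norm_num) (by norm_num))
    (ha 3 (by norm_num) (by norm_num)) (GenEta.etaRoot_ne_zero τ) hn ?_ ?_ hs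
    (GenEta.eta_quotient_eq_qProdPair hτ) ?_
  · rwa [← GenEta.nome_eq_etaRoot_pow]
  · rwa [← GenEta.nome_eq_etaRoot_pow]
  -- With s = w^98 n_0 from `hs`, the claim is s t = 2p, an identity of eta quotients.
  · rw [mul_right_comm, mul_comm (GenEta.qProdPair _ _), ← hs]
    field_simp
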